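/- Let $G=(V,E)$ be a finite directed multigraph with source $s$, sink $t$, transit times $\tau:E\to\mathbb N_0$ and unit capacities, and suppose that $G$ is a two-terminal series-parallel network with terminals $s,t$: it arises from single edges $a\to b$ with $a\neq b$ by series compositions (identifying the sink of the first network with the source of the second) and parallel compositions (identifying the two sources and the two sinks). Run the successive shortest path algorithm (Wilkinson): start with the zero flow; as long as the static residual network contains an $s$-$t$-path, choose a shortest (simple) $s$-$t$-path in it, ties being broken arbitrarily, and send one unit of flow along it. Here the residual network contains an edge in forward direction, with cost $\tau(e)$, while its capacity is not used, and in backward direction, with cost $-\tau(e)$, while it carries flow. From the resulting paths $P_1,P_2,\dots$ build a list of edges, starting with the empty list. Treat the paths in order of occurrence, and along each path, from $s$ to $t$, every edge $e$ together with the subsequent edge $e'$: if $e'$ is used in forward direction, then $e$ is added at the end of the list if $e$ is used for the first time in the whole procedure; if $e$ is used in forward and $e'$ in backward direction, then $e$ is inserted in the list directly in front of $e'$; in all other cases nothing is done. Finally, all edges that do not appear in the list are added at its end, in any order. Then, whatever choices are made, the procedure terminates (every run has at most $|E|$ iterations, and every partial run can be continued to a complete one), and the list built from a complete run is feasible, i.e.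 every edge occurs in it at most once, both before and after the missing edges are added. In particular the final global priority list contains every edge of $G$ exactly once. -/

import Mathlib

/-- A network: a finite directed multigraph (parallel edges and loops are allowed) with integral
capacities `u`, integral non-negative transit times `τ`, a source `s` and a sink `t`.
(Finiteness of `V` and `E` is imposed by type class arguments where it is needed.) -/
structure Network (V E : Type*) where
  src : E → V
  tgt : E → V
  u : E → ℕ
  τ : E → ℕ
  s : V
  t : V

/-- `SeriesParallel src tgt W A a b`: the subgraph with node set `W` and edge set `A` is a
(directed, two-terminal) series-parallel network with source `a` and sink `b`, i.e. it arises
from single edges by series and parallel compositions.  As all the pieces live in one ambient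
multigraph, "glue at the terminals only" says that the pieces share no edge and no node besides
the identified terminals. -/
inductive SeriesParallel {V E : Type*} (src tgt : E → V) : Set V → Set E → V → V → Prop
  | edge (e : E) (h : src e ≠ tgt e) :
      SeriesParallel src tgt {src e, tgt e} {e} (src e) (tgt e)
  | series {W₁ W₂ : Set V} {A₁ A₂ : Set E} {a b c : V}
      (h₁ : SeriesParallel src tgt W₁ A₁ a b) (h₂ : SeriesParallel src tgt W₂ A₂ b c)
      (hW : W₁ ∩ W₂ = {b}) (hA : Disjoint A₁ A₂) :
      SeriesParallel src tgt (W₁ ∪ W₂) (A₁ ∪ A₂) a c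
  | parallel {W₁ W₂ : Set V} {A₁ A₂ : Set E} {a b : V}
      (h₁ : SeriesParallel src tgt W₁ A₁ a b) (h₂ : SeriesParallel src tgt W₂ A₂ a b)
      (hW : W₁ ∩ W₂ = {a, b}) (hA : Disjoint A₁ A₂) :
      SeriesParallel src tgt (W₁ ∪ W₂) (A₁ ∪ A₂) a b

/-- The arcs of residual networks: every edge in forward or in backward direction. -/
inductive ResArc (E : Type*) where
  | fwd (e : E) : ResArc E
  | bwd (e : E) : ResArc E
  deriving DecidableEq

/-- The underlying edge of a residual arc. -/
def ResArc.edge {E : Type*} : ResArc E → E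
  | .fwd e => e
  | .bwd e => e

namespace Network

variable {V E : Type*} (N : Network V E)

/-- The whole network is series-parallel with terminals `s` and `t`. -/
def IsSeriesParallel : Prop :=
  SeriesParallel N.src N.tgt Set.univ Set.univ N.s N.t

def HasUnitCapacities : Prop := ∀ e, N.u e = 1

/-- Start node of a residual arc. -/
def tail : ResArc E → V
  | .fwd e => N.src e
  | .bwd e => N.tgt e

/-- End node of a residual arc. -/
def head : ResArc E → V
  | .fwd e => N.tgt e
  | .bwd e => N.src e

/-- Cost of a residual arc: the transit time, negated for backward arcs. -/
def cost : ResArc E → ℤ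
  | .fwd e => (N.τ e : ℤ)
  | .bwd e => -(N.τ e : ℤ)

/-- The arc has positive residual capacity with respect to the static flow `f`. -/
def IsResidual (f : E → ℤ) : ResArc E → Prop
  | .fwd e => f e < (N.u e : ℤ)
  | .bwd e => 0 < f e

/-- The list of arcs `p` is a walk from `a` to `b`. -/
def IsWalk : V → List (ResArc E) → V → Prop
  | a, [], b => a = b
  | a, x :: p, b => N.tail x = a ∧ IsWalk (N.head x) p b

/-- `p` is an `s`-`t`-path in the residual network of `f`; no node is visited twice. -/
def IsResidualPath (f : E → ℤ) (p : List (ResArc E)) : Prop :=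
  N.IsWalk N.s p N.t ∧ (N.s :: p.map N.head).Nodup ∧ ∀ x ∈ p, N.IsResidual f x

/-- The length of a path, i.e. the sum of the costs of its arcs. -/
def length (p : List (ResArc E)) : ℤ := (p.map N.cost).sum

/-- `p` is a shortest `s`-`t`-path in the residual network of `f`. -/
def IsShortestPath (f : E → ℤ) (p : List (ResArc E)) : Prop :=
  N.IsResidualPath f p ∧ ∀ q, N.IsResidualPath f q → N.length p ≤ N.length q

variable [DecidableEq E]

/-- Send one unit of flow along `p`. -/
def augment (f : E → ℤ) (p : List (ResArc E)) : E → ℤ :=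
  fun e => f e + (p.count (.fwd e) : ℤ) - (p.count (.bwd e) : ℤ)

/-- The static flow obtained from `f` by sending one unit along each of the given paths. -/
def flowAfter (f : E → ℤ) (ps : List (List (ResArc E))) : E → ℤ :=
  ps.foldl augment f

/-- `ps` is the sequence of paths of the first iterations of the successive shortest path
algorithm started with the flow `f`; ties between shortest paths are broken arbitrarily. -/
def IsRunFrom : (E → ℤ) → List (List (ResArc E)) → Prop
  | _, [] => True
  | f, p :: ps => N.IsShortestPath f p ∧ IsRunFrom (augment f p) ps

/-- `ps` is the sequence of paths of the first iterations of the algorithm, which starts with the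
zero flow. -/
def IsRun (ps : List (List (ResArc E))) : Prop := N.IsRunFrom (fun _ => 0) ps

/-- `ps` is the sequence of paths of a terminated run: the capacity of the network is exhausted,
i.e. there is no `s`-`t`-path left in the residual network. -/
def IsCompleteRun (ps : List (List (ResArc E))) : Prop :=
  N.IsRun ps ∧ ¬ ∃ p, N.IsResidualPath (flowAfter (fun _ => 0) ps) p

end Network

namespace PriorityList

variable {E : Type*} [DecidableEq E]

/-- Insert `e` immediately in front of (the first occurrence of) `e'`.  If `e'` does not occur,
`e` is put at the end. -/
def insertBefore (e e' : E) : List E → List E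
  | [] => [e]
  | x :: L => if x = e' then e :: x :: L else x :: insertBefore e e' L

/-- Treat one path, going through its pairs of an arc and the subsequent arc; `used` lists the
edges used before (in any direction), `L` is the current list.
* Subsequent arc forward: the edge is put at the end of the list if it is used for the first time.
* Forward arc followed by a backward arc of `e'`: the edge is put in front of `e'`.
* In all other cases (in particular for the last arc of the path) nothing is done. -/
def processPath (used : List E) : List (ResArc E) → List E → List E
  | [], L => L
  | [_], L => L
  | a :: .fwd e' :: p, L =>
      processPath (a.edge :: used) (.fwd e' :: p) (if a.edge ∈ used then L else L ++ [a.edge])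
  | .fwd e :: .bwd e' :: p, L =>
      processPath (e :: used) (.bwd e' :: p) (insertBefore e e' L)
  | .bwd e :: .bwd e' :: p, L =>
      processPath (e :: used) (.bwd e' :: p) L

/-- Treat the paths in order of their occurrence. -/
def processPaths : (used : List E) → List (List (ResArc E)) → List E → List E
  | _, [], L => L
  | used, p :: ps, L =>
      processPaths (used ++ p.map ResArc.edge) ps (processPath used p L)

/-- The list constructed from the sequence of paths `ps`. -/
def build (ps : List (List (ResArc E))) : List E := processPaths [] ps []

/-- `π` arises from `L` by adding all the edges that do not appear in `L` at the end, once each and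
in an arbitrary order. -/
def IsCompletion (L π : List E) : Prop :=
  ∃ R : List E, R.Nodup ∧ (∀ e, e ∈ R ↔ e ∉ L) ∧ π = L ++ R

/-- Feasible list: each edge occurs at most once. -/
def IsFeasible (π : List E) : Prop := ∀ e, π.count e ≤ 1

end PriorityList

/-! In a two-terminal series-parallel network, a simple walk between the terminals cannot traverse
an edge backward, even when edge directions are ignored (`SeriesParallel.forward_of_isWalk`). Hence
every augmenting path is a directed path, flow is never cancelled, and the insertion rule never
fires: the list grows only by appending edges at their first use, so it has no duplicates
(`processPaths_map_fwd_nodup`). With unit capacities the nonempty paths are also edge-disjoint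
(`exists_edge_disjoint`), which bounds the number of iterations by the number of edges. -/

namespace SeriesParallel

variable {V E : Type*} {src tgt : E → V} {W : Set V} {A : Set E} {a b : V}

theorem source_mem (h : SeriesParallel src tgt W A a b) : a ∈ W := by
  induction h with
  | edge e h => simp
  | series _ _ _ _ ih₁ _ => exact Or.inl ih₁
  | parallel _ _ _ _ ih₁ _ => exact Or.inl ih₁

theorem sink_mem (h : SeriesParallel src tgt W A a b) : b ∈ W := by
  induction h with
  | edge e h => simp
  | series _ _ _ _ _ ih₂ => exact Or.inr ih₂
  | parallel _ _ _ _ ih₁ _ => exact Or.inl ih₁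

theorem ends_mem (h : SeriesParallel src tgt W A a b) : ∀ e ∈ A, src e ∈ W ∧ tgt e ∈ W := by
  induction h with
  | edge e h => rintro _ rfl; simp
  | series _ _ _ _ ih₁ ih₂ | parallel _ _ _ _ ih₁ ih₂ =>
    rintro e (he | he)
    · exact ⟨Or.inl (ih₁ e he).1, Or.inl (ih₁ e he).2⟩
    · exact ⟨Or.inr (ih₂ e he).1, Or.inr (ih₂ e he).2⟩

/-- In the series case, a node that is both source and sink would lie in both pieces and so equal
the gluing node, which already differs from the source of the first piece. -/
theorem source_ne_sink (h : SeriesParallel src tgt W A a b) : a ≠ b := by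
  induction h with
  | edge e h => exact h
  | @series W₁ W₂ _ _ a b c h₁ h₂ hW _ ih₁ _ =>
    rintro rfl
    have : a ∈ W₁ ∩ W₂ := ⟨h₁.source_mem, h₂.sink_mem⟩
    rw [hW] at this
    exact ih₁ this
  | parallel _ _ _ _ ih₁ _ => exact ih₁

end SeriesParallel

/-! ### Simple walks in series-parallel networks -/

namespace Network

variable {V E : Type*} (N : Network V E)

theorem isWalk_append {a c : V} {p q : List (ResArc E)} :
    N.IsWalk a (p ++ q) c ↔ ∃ b, N.IsWalk a p b ∧ N.IsWalk b q c := by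
  induction p generalizing a with
  | nil => simp [IsWalk]
  | cons x p ih => simp [IsWalk, ih, and_assoc]

variable {N}

theorem IsWalk.end_mem {a b : V} {p : List (ResArc E)} (h : N.IsWalk a p b) :
    b ∈ a :: p.map N.head := by
  induction p generalizing a with
  | nil => simp [show a = b from h]
  | cons x p ih => exact List.mem_cons_of_mem _ (by simpa using ih h.2)

theorem tail_head_mem {W : Set V} {A : Set E}
    (h : ∀ e ∈ A, N.src e ∈ W ∧ N.tgt e ∈ W) {x : ResArc E} (hx : x.edge ∈ A) :
    N.tail x ∈ W ∧ N.head x ∈ W := by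
  cases x with
  | fwd e => exact h e hx
  | bwd e => exact (h e hx).symm

/-- A walk that meets the separator `W₁ ∩ W₂` only at its ends stays on the side of its
first arc. -/
theorem IsWalk.stays_in_side {W₁ W₂ : Set V} {A₁ A₂ : Set E}
    (h₁ : ∀ e ∈ A₁, N.src e ∈ W₁ ∧ N.tgt e ∈ W₁) (h₂ : ∀ e ∈ A₂, N.src e ∈ W₂ ∧ N.tgt e ∈ W₂)
    {a b : V} {x : ResArc E} {p : List (ResArc E)} (hw : N.IsWalk a (x :: p) b)
    (hA : ∀ y ∈ p, y.edge ∈ A₁ ∪ A₂) (hx : x.edge ∈ A₁)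
    (hsep : ∀ y ∈ p, N.tail y ∉ W₁ ∩ W₂) :
    (∀ y ∈ x :: p, y.edge ∈ A₁) ∧ b ∈ W₁ := by
  induction p generalizing a x with
  | nil =>
    have hb : N.head x = b := hw.2
    exact ⟨by simpa using hx, hb ▸ (tail_head_mem h₁ hx).2⟩
  | cons y p ih =>
    have hy : y.edge ∈ A₁ := by
      rcases hA y (by simp) with hy | hy
      · exact hy
      -- Leaving the side of `A₁` is possible only at a node of both sides, i.e. in the separator.
      · refine absurd ⟨?_, (tail_head_mem h₂ hy).1⟩ (hsep y (by simp))
        rw [hw.2.1]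
        exact (tail_head_mem h₁ hx).2
    obtain ⟨h, hb⟩ := ih hw.2 (fun z hz => hA z (by simp [hz])) hy
      (fun z hz => hsep z (by simp [hz]))
    exact ⟨by simpa using ⟨hx, by simpa using h⟩, hb⟩

/-- The inner nodes of a simple walk differ from both of its ends. -/
theorem IsWalk.tail_ne {a b : V} {x : ResArc E} {p : List (ResArc E)}
    (hw : N.IsWalk a (x :: p) b) (hn : (a :: (x :: p).map N.head).Nodup) :
    ∀ y ∈ p, N.tail y ≠ a ∧ N.tail y ≠ b := by
  intro y hy
  obtain ⟨q, r, rfl⟩ := List.append_of_mem hy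
  rw [← List.cons_append, isWalk_append] at hw
  obtain ⟨c, hq, hr⟩ := hw
  rw [hr.1]
  have hc : c ∈ (x :: q).map N.head := by simpa using hq.2.end_mem
  have hb : b ∈ (y :: r).map N.head := by simpa using hr.2.end_mem
  rw [← List.cons_append, List.map_append, List.nodup_cons, List.nodup_append] at hn
  refine ⟨fun h => hn.1 (List.mem_append_left _ (h ▸ hc)), hn.2.2.2 c hc b hb⟩

/-- In a series-parallel network, every simple walk between the terminals, in the underlying
undirected graph, uses forward arcs only. -/
theorem _root_.SeriesParallel.forward_of_isWalk {W : Set V} {A : Set E} {a b : V}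
    (h : SeriesParallel N.src N.tgt W A a b) {p : List (ResArc E)} (hw : N.IsWalk a p b)
    (hn : (a :: p.map N.head).Nodup) (hA : ∀ x ∈ p, x.edge ∈ A) :
    ∀ x ∈ p, ∃ e, x = .fwd e := by
  induction h generalizing p with
  | edge e h =>
    rintro (e' | e') hx
    · exact ⟨e', rfl⟩
    -- The backward arc would end at the start node, which a simple walk does not revisit.
    · obtain rfl : e' = e := hA _ hx
      exact absurd (List.mem_map_of_mem (f := N.head) hx) (List.nodup_cons.1 hn).1
  | @series W₁ W₂ A₁ A₂ a b c h₁ h₂ hW _ ih₁ ih₂ =>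
    have hcb : c ∉ W₁ := fun hc => by
      have : c ∈ W₁ ∩ W₂ := ⟨hc, h₂.sink_mem⟩
      rw [hW] at this
      exact h₂.source_ne_sink this.symm
    have hab : a ∉ W₂ := fun ha => by
      have : a ∈ W₁ ∩ W₂ := ⟨h₁.source_mem, ha⟩
      rw [hW] at this
      exact h₁.source_ne_sink this
    have first : ∀ {x : ResArc E} {q : List (ResArc E)} {d : V}, N.IsWalk a (x :: q) d →
        x.edge ∈ A₁ ∪ A₂ → x.edge ∈ A₁ := by
      rintro x q d hq (hx | hx)
      · exact hx
      · exact absurd (hq.1 ▸ (tail_head_mem h₂.ends_mem hx).1) hab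
    -- The walk must pass the gluing node `b`; it is split there into a simple walk through each
    -- piece.
    by_cases hb : ∃ y ∈ p, N.tail y = b
    · obtain ⟨y, hy, rfl⟩ := hb
      obtain ⟨q, r, rfl⟩ := List.append_of_mem hy
      obtain ⟨d, hq, hr⟩ := (N.isWalk_append).1 hw
      obtain rfl : N.tail y = d := hr.1
      have hnq : (a :: q.map N.head).Nodup :=
        hn.sublist (by simp)
      have hnr : (N.tail y :: (y :: r).map N.head).Nodup := by
        have hm := hq.end_mem
        rw [List.map_append, ← List.cons_append, List.nodup_append] at hn
        exact List.nodup_cons.2 ⟨fun h => hn.2.2 _ hm _ h rfl, hn.2.1⟩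
      have hr₂ : ∀ z ∈ y :: r, z.edge ∈ A₂ := by
        have hsep : ∀ z ∈ r, N.tail z ∉ W₁ ∩ W₂ := fun z hz => by
          rw [hW]; exact (hr.tail_ne hnr z hz).1
        -- After `b` the walk does not meet the separator again; starting into `A₁` would trap it in
        -- `W₁`, which misses `c`.
        rcases hA y hy with hy₁ | hy₂
        · exact absurd (hr.stays_in_side h₁.ends_mem h₂.ends_mem
            (fun z hz => hA z (by simp [hz])) hy₁ hsep).2 hcb
        · exact (hr.stays_in_side h₂.ends_mem h₁.ends_mem
            (fun z hz => (hA z (by simp [hz])).symm) hy₂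
            (fun z hz => by rw [Set.inter_comm]; exact hsep z hz)).1
      have hq₁ : ∀ z ∈ q, z.edge ∈ A₁ := by
        cases q with
        | nil => simp
        | cons x q =>
          exact (hq.stays_in_side h₁.ends_mem h₂.ends_mem (fun z hz => hA z (by simp [hz]))
            (first hq (hA x (by simp)))
            (fun z hz => by rw [hW]; exact (hq.tail_ne hnq z hz).2)).1
      intro x hx
      rcases List.mem_append.1 hx with hx | hx
      · exact ih₁ hq hnq hq₁ x hx
      · exact ih₂ hr hnr hr₂ x hx
    · push Not at hb
      cases p with
      | nil => simp
      | cons x p =>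
        exact absurd (hw.stays_in_side h₁.ends_mem h₂.ends_mem (fun z hz => hA z (by simp [hz]))
          (first hw (hA x (by simp)))
          (fun z hz => by rw [hW]; exact hb z (by simp [hz]))).2 hcb
  | @parallel W₁ W₂ A₁ A₂ a b h₁ h₂ hW _ ih₁ ih₂ =>
    cases p with
    | nil => simp
    | cons x p =>
      -- The separator consists of the two terminals, which no inner node of a simple walk meets, so
      -- the walk stays in one piece.
      have hsep : ∀ z ∈ p, N.tail z ∉ W₁ ∩ W₂ := fun z hz => by
        rw [hW]
        have := hw.tail_ne hn z hz
        simpa using this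
      rcases hA x (by simp) with hx | hx
      · exact ih₁ hw hn (hw.stays_in_side h₁.ends_mem h₂.ends_mem
          (fun z hz => hA z (by simp [hz])) hx hsep).1
      · exact ih₂ hw hn (hw.stays_in_side h₂.ends_mem h₁.ends_mem
          (fun z hz => (hA z (by simp [hz])).symm) hx
          (fun z hz => by rw [Set.inter_comm]; exact hsep z hz)).1

/-! ### Runs of the algorithm: shortest paths, disjointness, termination -/

theorem IsSeriesParallel.exists_eq_map_fwd (hSP : N.IsSeriesParallel) {f : E → ℤ}
    {p : List (ResArc E)} (hp : N.IsResidualPath f p) :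
    ∃ es : List E, p = es.map .fwd ∧ es ≠ [] ∧ es.Nodup := by
  have hfwd := SeriesParallel.forward_of_isWalk hSP hp.1 hp.2.1 (by simp)
  have hes : p = (p.map ResArc.edge).map .fwd := by
    rw [List.map_map]
    refine (List.map_id p).symm.trans (List.map_congr_left fun x hx => ?_)
    obtain ⟨e, rfl⟩ := hfwd x hx
    rfl
  refine ⟨p.map ResArc.edge, hes, ?_, ?_⟩
  · intro h
    obtain rfl : p = [] := List.map_eq_nil_iff.1 h
    exact SeriesParallel.source_ne_sink hSP hp.1
  · have := (List.nodup_cons.1 hp.2.1).2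
    rw [hes, List.map_map] at this
    exact this.of_map _

/-- Forward arcs have nonnegative cost, so minimizing `toNat` of the length, which is well-founded,
minimizes the length itself. -/
theorem IsSeriesParallel.exists_isShortestPath (hSP : N.IsSeriesParallel) {f : E → ℤ}
    (h : ∃ p, N.IsResidualPath f p) : ∃ p, N.IsShortestPath f p := by
  obtain ⟨p, hp, hmin⟩ := WellFounded.has_min
    (InvImage.wf (fun p => (N.length p).toNat) Nat.lt_wfRel.wf) {p | N.IsResidualPath f p} h
  have nonneg : ∀ q, N.IsResidualPath f q → 0 ≤ N.length q := fun q hq => by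
    obtain ⟨es, rfl, -, -⟩ := hSP.exists_eq_map_fwd hq
    refine List.sum_nonneg ?_
    simp [cost]
  refine ⟨p, hp, fun q hq => ?_⟩
  have h₁ : ¬ (N.length q).toNat < (N.length p).toNat := hmin q hq
  have h₂ := nonneg q hq
  omega

variable [DecidableEq E]

theorem augment_map_fwd (f : E → ℤ) (es : List E) :
    augment f (es.map .fwd) = fun e => f e + es.count e := by
  funext e
  have h₁ : (es.map ResArc.fwd).count (.fwd e) = es.count e :=
    List.count_map_of_injective _ _ (fun _ _ h => ResArc.fwd.inj h) _
  have h₂ : (es.map ResArc.fwd).count (.bwd e) = 0 := by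
    simp [List.count_eq_zero]
  simp [augment, h₁, h₂]

theorem isRunFrom_append {f : E → ℤ} {ps qs : List (List (ResArc E))} :
    N.IsRunFrom f (ps ++ qs) ↔ N.IsRunFrom f ps ∧ N.IsRunFrom (flowAfter f ps) qs := by
  induction ps generalizing f with
  | nil => simp [IsRunFrom, flowAfter]
  | cons p ps ih => simp [IsRunFrom, flowAfter, ih, and_assoc]

/-- In a series-parallel network with unit capacities, the paths of a run are directed and
pairwise edge-disjoint. -/
theorem IsSeriesParallel.exists_edge_disjoint (hSP : N.IsSeriesParallel)
    (hu : N.HasUnitCapacities) {used : List E} (hused : used.Nodup)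
    {ps : List (List (ResArc E))} (hr : N.IsRunFrom (fun e => (used.count e : ℤ)) ps) :
    ∃ ess : List (List E), ps = ess.map (List.map .fwd) ∧ (∀ es ∈ ess, es ≠ []) ∧
      (used ++ ess.flatten).Nodup := by
  induction ps generalizing used with
  | nil => exact ⟨[], by simpa using hused⟩
  | cons p ps ih =>
    obtain ⟨es, rfl, hne, hnd⟩ := hSP.exists_eq_map_fwd hr.1.1
    -- The flow on `e` equals its multiplicity in `used`; residual capacity of the forward arc
    -- forces this below 1.
    have hdisj : ∀ e ∈ es, e ∉ used := fun e he hmem => by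
      have h₁ : (used.count e : ℤ) < (N.u e : ℤ) := hr.1.1.2.2 (.fwd e) (List.mem_map_of_mem he)
      have h₂ := List.count_pos_iff.2 hmem
      rw [hu e] at h₁
      omega
    have hnd' : (used ++ es).Nodup :=
      List.nodup_append.2 ⟨hused, hnd, fun x hx y hy hxy => hdisj y hy (hxy ▸ hx)⟩
    have hr' := hr.2
    rw [augment_map_fwd] at hr'
    obtain ⟨ess, rfl, hnes, hess⟩ := ih hnd' (by simpa [List.count_append] using hr')
    exact ⟨es :: ess, by simp, by simpa using ⟨hne, hnes⟩, by simpa using hess⟩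

theorem IsSeriesParallel.length_le_card [Fintype E] (hSP : N.IsSeriesParallel)
    (hu : N.HasUnitCapacities) {ps : List (List (ResArc E))} (hr : N.IsRun ps) :
    ps.length ≤ Fintype.card E := by
  obtain ⟨ess, rfl, hne, hnd⟩ := hSP.exists_edge_disjoint hu (used := []) List.nodup_nil
    (by simpa [IsRun] using hr)
  rw [List.nil_append] at hnd
  refine le_trans ?_ hnd.length_le_card
  rw [List.length_map, List.length_flatten, ← List.length_map (f := List.length)]
  refine List.length_le_sum_of_one_le _ fun n hn => ?_
  obtain ⟨es, hes, rfl⟩ := List.mem_map.1 hn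
  exact List.length_pos_of_ne_nil (hne es hes)

theorem IsSeriesParallel.exists_isCompleteRun [Fintype E] (hSP : N.IsSeriesParallel)
    (hu : N.HasUnitCapacities) {ps : List (List (ResArc E))} (hr : N.IsRun ps) :
    ∃ qs, N.IsCompleteRun (ps ++ qs) := by
  induction hk : Fintype.card E - ps.length using Nat.strong_induction_on generalizing ps with
  | _ k ih =>
    by_cases h : ∃ p, N.IsResidualPath (flowAfter (fun _ => 0) ps) p
    · obtain ⟨p, hp⟩ := hSP.exists_isShortestPath h
      have hr' : N.IsRun (ps ++ [p]) := isRunFrom_append.2 ⟨hr, hp, trivial⟩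
      -- The bound for the extended run makes the truncated difference `Fintype.card E - ps.length`
      -- strictly decrease.
      have hlen := hSP.length_le_card hu hr'
      rw [List.length_append, List.length_singleton] at hlen
      obtain ⟨qs, hqs⟩ := ih _ (by rw [List.length_append, List.length_singleton]; omega) hr' rfl
      exact ⟨p :: qs, by simpa using hqs⟩
    · exact ⟨[], by simpa [IsCompleteRun] using ⟨hr, by simpa using h⟩⟩

end Network

/-! ### The list built from forward paths -/

namespace PriorityList

variable {E : Type*}

theorem IsCompletion.nodup {L π : List E} (hL : L.Nodup) (h : IsCompletion L π) : π.Nodup := by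
  obtain ⟨R, hR, hmem, rfl⟩ := h
  exact List.nodup_append.2 ⟨hL, hR, fun x hx y hy hxy => (hmem y).1 hy (hxy ▸ hx)⟩

theorem IsCompletion.mem {L π : List E} (h : IsCompletion L π) (e : E) : e ∈ π := by
  obtain ⟨R, -, hmem, rfl⟩ := h
  rw [List.mem_append, hmem]
  exact em _

variable [DecidableEq E]

/-- The invariant is that listed edges are used edges, so an edge passing the first-use test is new
to the list. The inclusion restores the invariant for the next path; it may be strict, since the
last edge of a path is used but not appended. -/
theorem processPath_map_fwd (es : List E) {used L : List E} (hL : L.Nodup) (hsub : L ⊆ used) :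
    (processPath used (es.map .fwd) L).Nodup ∧
      processPath used (es.map .fwd) L ⊆ used ++ es := by
  induction es generalizing used L with
  | nil => exact ⟨hL, by simpa [processPath] using hsub⟩
  | cons e es ih =>
    cases es with
    | nil => exact ⟨hL, fun x hx => List.mem_append_left _ (hsub hx)⟩
    | cons e' es =>
      have key : ∀ {L' : List E}, L'.Nodup → L' ⊆ e :: used →
          (processPath (e :: used) ((e' :: es).map .fwd) L').Nodup ∧
          processPath (e :: used) ((e' :: es).map .fwd) L' ⊆ used ++ e :: e' :: es := by
        intro L' h₁ h₂
        refine ⟨(ih h₁ h₂).1, fun x hx => ?_⟩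
        have hx' := (ih h₁ h₂).2 hx
        simp only [List.mem_append, List.mem_cons] at hx' ⊢
        tauto
      rw [List.map_cons, List.map_cons, processPath]
      change (processPath (e :: used) _ (if e ∈ used then L else L ++ [e])).Nodup ∧
        processPath (e :: used) _ (if e ∈ used then L else L ++ [e]) ⊆ _
      by_cases h : e ∈ used
      · rw [if_pos h]
        exact key hL fun x hx => List.mem_cons_of_mem _ (hsub hx)
      · rw [if_neg h]
        refine key (List.nodup_append.2 ⟨hL, List.nodup_singleton e, ?_⟩) fun x hx => ?_
        · rintro x hx y hy rfl
          exact h (List.mem_singleton.1 hy ▸ hsub hx)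
        · rcases List.mem_append.1 hx with hx | hx
          · exact List.mem_cons_of_mem _ (hsub hx)
          · exact List.mem_singleton.1 hx ▸ List.mem_cons_self

theorem processPaths_map_fwd_nodup (ess : List (List E)) {used L : List E} (hL : L.Nodup)
    (hsub : L ⊆ used) : (processPaths used (ess.map (List.map .fwd)) L).Nodup := by
  induction ess generalizing used L with
  | nil => exact hL
  | cons es ess ih =>
    obtain ⟨h₁, h₂⟩ := processPath_map_fwd es hL hsub
    have hes : (es.map ResArc.fwd).map ResArc.edge = es := by
      rw [List.map_map]; exact List.map_id es
    rw [List.map_cons, processPaths, hes]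
    exact ih h₁ h₂

end PriorityList

theorem mainTheorem12 {V E : Type*} [Fintype V] [Fintype E] [DecidableEq E]
    (N : Network V E) (hSP : N.IsSeriesParallel) (hu : N.HasUnitCapacities) :
    -- the procedure terminates, whatever choices are made among shortest paths
    (∀ ps, N.IsRun ps →
      ps.length ≤ Fintype.card E ∧ ∃ qs, N.IsCompleteRun (ps ++ qs)) ∧
    -- and the list it computes is always feasible
    (∀ ps, N.IsCompleteRun ps →
      PriorityList.IsFeasible (PriorityList.build ps) ∧
      ∀ π, PriorityList.IsCompletion (PriorityList.build ps) π →
        PriorityList.IsFeasible π ∧ ∀ e, e ∈ π) := by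
  refine ⟨fun ps hr => ⟨hSP.length_le_card hu hr, hSP.exists_isCompleteRun hu hr⟩,
    fun ps hr => ?_⟩
  obtain ⟨ess, rfl, -, -⟩ := hSP.exists_edge_disjoint hu (used := []) List.nodup_nil
    (by simpa [Network.IsRun] using hr.1)
  have hnd : (PriorityList.build (ess.map (List.map ResArc.fwd))).Nodup :=
    PriorityList.processPaths_map_fwd_nodup ess List.nodup_nil (List.Subset.refl _)
  exact ⟨List.nodup_iff_count_le_one.1 hnd,
    fun π hπ => ⟨List.nodup_iff_count_le_one.1 (hπ.nodup hnd), hπ.mem⟩⟩
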